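/- Let $\Bbbk$ be a field and let $R=\Bbbk[x,y,z,w]$. Let $F$ be the following complex of free $R$-modules (with basis elements in the degrees shown): \begin{align*} F_0&=R\cdot 1, & F_1&=\bigoplus_{i=1}^{5} R\varepsilon_i, & F_2&=R\varepsilon_{12}\oplus R\varepsilon_{13}\oplus R\varepsilon_{14}\oplus R\varepsilon_{23}\oplus R\varepsilon_{24}\oplus R\varepsilon_{35}\oplus R\varepsilon_{45},\\ F_3&=R\varepsilon_{123}\oplus R\varepsilon_{124}\oplus R\varepsilon_{1345}\oplus R\varepsilon_{2345}, & F_4&=R\varepsilon_{12345}, & F_n&=0\ \text{ otherwise.} \end{align*} Put $m_1=x^2$, $m_2=w^2$, $m_3=zw$, $m_4=xy$, $m_5=yz$. The differential $\mathrm d$ is the $R$-linear map with $\mathrm d(1)=0$, $\mathrm d(\varepsilon_i)=m_i$, $\mathrm d(\varepsilon_{ij})=\frac{m_{ij}}{m_j}\varepsilon_j-\frac{m_{ij}}{m_i}\varepsilon_i$ where $m_{ij}=\mathrm{lcm}(m_i,m_j)$, and \begin{align*} \mathrm d(\varepsilon_{123})&=x^2\varepsilon_{23}-w\varepsilon_{13}+z\varepsilon_{12},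 & \mathrm d(\varepsilon_{1345})&=x^2\varepsilon_{35}-xw\varepsilon_{45}-zw\varepsilon_{14}+y\varepsilon_{13},\\ \mathrm d(\varepsilon_{124})&=x\varepsilon_{24}-w^2\varepsilon_{14}+y\varepsilon_{12}, & \mathrm d(\varepsilon_{2345})&=xw\varepsilon_{35}-w^2\varepsilon_{45}-z\varepsilon_{24}+xy\varepsilon_{23},\\ \mathrm d(\varepsilon_{12345})&=x\varepsilon_{2345}-w\varepsilon_{1345}+z\varepsilon_{124}-y\varepsilon_{123}. \end{align*} A \emph{multiplication} on $F$ is a chain map $\mu\colon F\otimes_R F\to F$, written $\mu(a\otimes b)=ab$, which is unital (there is $e\in F$ with $ea=a=ae$ for all $a\in F$) and strictly graded-commutative ($ab=(-1)^{|a||b|}ba$ for homogeneous $a,b$, and $a^2=0$ for homogeneous $a$ of odd degree); it need not be associative. Then $F$ is the minimal (multigraded) free resolution of $R/(x^2,w^2,zw,xy,yz)$ over $R$, and every multiplication on $F$ is non-associative at the triple $(\varepsilon_1,\varepsilon_{45},\varepsilon_2)$; that is, \[ (\varepsilon_1\varepsilon_{45})\varepsilon_2-\varepsilon_1(\varepsilon_{45}\varepsilon_2)\neq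 0 . \] -/

import Mathlib

/-! ### Not necessarily associative differential graded structures

A nonnegatively graded complex over `R` is given by a module `A`, its homogeneous components
`𝒜 n ⊆ A`, and its differential `d : A → A`. -/

/-- `μ` is a multiplication on the complex `(A, 𝒜, d)`: a chain map `A ⊗ A → A` (that is, a
bilinear map which respects degrees and satisfies the Leibniz rule) which is unital and strictly
graded-commutative. Associativity is not required. -/
structure IsMultiplication {R A : Type*} [CommRing R] [AddCommGroup A] [Module R A]
    (𝒜 : ℕ → Submodule R A) (d : A →ₗ[R] A) (μ : A →ₗ[R] A →ₗ[R] A) : Prop where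
  mul_mem : ∀ i j : ℕ, ∀ a ∈ 𝒜 i, ∀ b ∈ 𝒜 j, μ a b ∈ 𝒜 (i + j)
  leibniz : ∀ i : ℕ, ∀ a ∈ 𝒜 i, ∀ b : A, d (μ a b) = μ (d a) b + (-1 : R) ^ i • μ a (d b)
  unital : ∃ e : A, ∀ a : A, μ e a = a ∧ μ a e = a
  graded_comm : ∀ i j : ℕ, ∀ a ∈ 𝒜 i, ∀ b ∈ 𝒜 j, μ a b = (-1 : R) ^ (i * j) • μ b a
  sq_zero : ∀ i : ℕ, Odd i → ∀ a ∈ 𝒜 i, μ a a = 0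

/-- The associator `[a, b, c] = (ab)c - a(bc)` of a bilinear product. -/
def associatorOf {R A : Type*} [CommRing R] [AddCommGroup A] [Module R A]
    (μ : A →ₗ[R] A →ₗ[R] A) (a b c : A) : A :=
  μ (μ a b) c - μ a (μ b c)

/-- `(A, 𝒜, d)` is a minimal (multigraded) free resolution of `k[X]/I` over the polynomial ring
`k[X] = MvPolynomial σ k`. -/
structure IsMinimalFreeResolution {σ k A : Type*} [Field k] [AddCommGroup A]
    [Module (MvPolynomial σ k) A] (I : Ideal (MvPolynomial σ k))
    (𝒜 : ℕ → Submodule (MvPolynomial σ k) A)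
    (d : A →ₗ[MvPolynomial σ k] A) : Prop where
  /-- `A` is the direct sum of its homogeneous components. -/
  isInternal : DirectSum.IsInternal 𝒜
  /-- `d` has degree `-1`. -/
  map_succ : ∀ n, ∀ a ∈ 𝒜 (n + 1), d a ∈ 𝒜 n
  map_zero : ∀ a ∈ 𝒜 0, d a = 0
  d_comp_d : ∀ a, d (d a) = 0
  /-- `A` has a finite basis, homogeneous for the homological grading, with a choice of
  multidegrees for which `d` preserves multidegrees. -/
  homogeneous_basis : ∃ (ι : Type) (_ : Fintype ι) (b : Module.Basis ι (MvPolynomial σ k) A)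
    (hdeg : ι → ℕ) (mdeg : ι → σ →₀ ℕ),
      (∀ i, b i ∈ 𝒜 (hdeg i)) ∧
      ∀ i j, ∀ s ∈ (b.repr (d (b i)) j).support, s + mdeg j = mdeg i
  /-- The homology vanishes in positive degrees. -/
  exact : ∀ n, ∀ a ∈ 𝒜 (n + 1), d a = 0 → ∃ b ∈ 𝒜 (n + 2), d b = a
  /-- The homology in degree zero is `k[X]/I`. -/
  augmentation : ∃ π : 𝒜 0 →ₗ[MvPolynomial σ k] (MvPolynomial σ k ⧸ I),
    Function.Surjective π ∧ ∀ a : 𝒜 0, π a = 0 ↔ ∃ b ∈ 𝒜 1, d b = a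
  /-- Minimality: `d(A) ⊆ 𝔪A`, where `𝔪` is generated by the variables. -/
  minimal : LinearMap.range d ≤
    Ideal.span (Set.range (MvPolynomial.X : σ → MvPolynomial σ k)) • (⊤ : Submodule (MvPolynomial σ k) A)

/-! ### The complex `F` resolving `k[x,y,z,w]/(x², w², zw, xy, yz)` -/

namespace Avramov

/-- Labels of the homogeneous basis of `F`; `one` is the basis element `1` of `F₀ = R`. -/
inductive Label : Type
  | one
  | e1 | e2 | e3 | e4 | e5
  | e12 | e13 | e14 | e23 | e24 | e35 | e45
  | e123 | e124 | e1345 | e2345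
  | e12345
  deriving DecidableEq

instance : Fintype Label where
  elems := {.one, .e1, .e2, .e3, .e4, .e5, .e12, .e13, .e14, .e23, .e24, .e35, .e45,
    .e123, .e124, .e1345, .e2345, .e12345}
  complete := by intro b; cases b <;> decide

/-- Homological degree of a basis element. -/
def Label.deg : Label → ℕ
  | .one => 0
  | .e1 | .e2 | .e3 | .e4 | .e5 => 1
  | .e12 | .e13 | .e14 | .e23 | .e24 | .e35 | .e45 => 2
  | .e123 | .e124 | .e1345 | .e2345 => 3
  | .e12345 => 4

/-- `R = k[x,y,z,w]`. -/
abbrev Poly (k : Type*) [Field k] : Type _ := MvPolynomial (Fin 4) k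

/-- The ideal `(x², w², zw, xy, yz)` of `k[x,y,z,w]`. -/
noncomputable def ideal (k : Type*) [Field k] : Ideal (Poly k) :=
  let x : Poly k := MvPolynomial.X 0
  let y : Poly k := MvPolynomial.X 1
  let z : Poly k := MvPolynomial.X 2
  let w : Poly k := MvPolynomial.X 3
  Ideal.span {x ^ 2, w ^ 2, z * w, x * y, y * z}

/-- The free `R`-module underlying `F`. -/
abbrev F (k : Type*) [Field k] : Type _ := Label → Poly k

/-- The basis element of `F` with a given label. -/
noncomputable def ε (k : Type*) [Field k] (b : Label) : F k := Pi.single b 1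

/-- The homogeneous component `Fₙ`, spanned by the basis elements of degree `n`. -/
noncomputable def grading (k : Type*) [Field k] (n : ℕ) : Submodule (Poly k) (F k) where
  carrier := {f | ∀ b : Label, b.deg ≠ n → f b = 0}
  add_mem' := by
    intro f g hf hg b hb
    simp [hf b hb, hg b hb]
  zero_mem' := by
    intro b _
    rfl
  smul_mem' := by
    intro r f hf b hb
    simp [hf b hb]

/-- The differential of `F` on basis elements. -/
noncomputable def dBasis (k : Type*) [Field k] : Label → F k :=
  let x : Poly k := MvPolynomial.X 0
  let y : Poly k := MvPolynomial.X 1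
  let z : Poly k := MvPolynomial.X 2
  let w : Poly k := MvPolynomial.X 3
  fun b => match b with
  | .one => 0
  | .e1 => x ^ 2 • ε k .one
  | .e2 => w ^ 2 • ε k .one
  | .e3 => (z * w) • ε k .one
  | .e4 => (x * y) • ε k .one
  | .e5 => (y * z) • ε k .one
  | .e12 => x ^ 2 • ε k .e2 - w ^ 2 • ε k .e1
  | .e13 => x ^ 2 • ε k .e3 - (z * w) • ε k .e1
  | .e14 => x • ε k .e4 - y • ε k .e1
  | .e23 => w • ε k .e3 - z • ε k .e2
  | .e24 => w ^ 2 • ε k .e4 - (x * y) • ε k .e2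
  | .e35 => w • ε k .e5 - y • ε k .e3
  | .e45 => x • ε k .e5 - z • ε k .e4
  | .e123 => x ^ 2 • ε k .e23 - w • ε k .e13 + z • ε k .e12
  | .e124 => x • ε k .e24 - w ^ 2 • ε k .e14 + y • ε k .e12
  | .e1345 => x ^ 2 • ε k .e35 - (x * w) • ε k .e45 - (z * w) • ε k .e14 + y • ε k .e13
  | .e2345 => (x * w) • ε k .e35 - w ^ 2 • ε k .e45 - z • ε k .e24 + (x * y) • ε k .e23
  | .e12345 => x • ε k .e2345 - w • ε k .e1345 + z • ε k .e124 - y • ε k .e123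

/-- The `R`-linear differential of `F`. -/
noncomputable def d (k : Type*) [Field k] : F k →ₗ[Poly k] F k :=
  (Pi.basisFun (Poly k) Label).constr (Poly k) (dBasis k)

end Avramov

namespace Avramov

open MvPolynomial

variable {k : Type*} [Field k]

/-! Exactness is an explicit syzygy computation. A variable is a nonzerodivisor modulo an ideal
generated by other variables, so each kernel relation can be divided variable by variable
(`exists_of_X_mul_eq_X_mul` and its variants) until a preimage appears.

For non-associativity, rescale `μ` so that `ε .one` is its unit. By `d_associator`, the boundary of
the associator `[ε₁, ε₄₅, ε₂]` is `-x[ε₁, ε₅, ε₂] + z[ε₁, ε₄, ε₂]`. Look at the coefficient of `x²`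
in its `ε₂₃₄₅` coordinate: the `z` term cannot contribute, so only the coefficient of `x` in `[ε₁,
ε₅, ε₂]` matters. There `(ε₁ε₅)ε₂` gives `-1` and `ε₁(ε₅ε₂)` gives `0`. Since `μ` need not respect
multidegrees, the products themselves are not determined, but the Leibniz rule forces these scalar
coefficients. -/

/-! ### The differential in coordinates, the grading and the augmentation. -/

theorem sum_label {M : Type*} [AddCommMonoid M] (g : Label → M) :
    ∑ b, g b = g .one + (g .e1 + (g .e2 + (g .e3 + (g .e4 + (g .e5 + (g .e12 + (g .e13 + (g .e14 +
      (g .e23 + (g .e24 + (g .e35 + (g .e45 + (g .e123 + (g .e124 + (g .e1345 + (g .e2345 +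
        g .e12345)))))))))))))))) := by
  change ∑ b ∈ ({.one, .e1, .e2, .e3, .e4, .e5, .e12, .e13, .e14, .e23, .e24, .e35, .e45,
    .e123, .e124, .e1345, .e2345, .e12345} : Finset Label), g b = _
  repeat rw [Finset.sum_insert (by decide)]
  rw [Finset.sum_singleton]

theorem d_eq_sum (f : F k) : d k f = ∑ b, f b • dBasis k b := by
  simp [d, Module.Basis.constr_apply_fintype, Pi.basisFun_equivFun]

@[simp]
theorem d_ε (b : Label) : d k (ε k b) = dBasis k b := by
  have := (Pi.basisFun (Poly k) Label).constr_basis (Poly k) (dBasis k) b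
  rwa [Pi.basisFun_apply] at this

theorem eq_sum_ε (f : F k) : f = ∑ b, f b • ε k b := by
  have := (Pi.basisFun (Poly k) Label).sum_repr f
  simpa [ε] using this.symm

/-- The components of `d f` in the coordinates of `f`. -/
theorem d_apply (f : F k) (l : Label) :
    d k f l =
      let x : Poly k := X 0
      let y : Poly k := X 1
      let z : Poly k := X 2
      let w : Poly k := X 3
      match l with
      | .one => x ^ 2 * f .e1 + w ^ 2 * f .e2 + z * w * f .e3 + x * y * f .e4 + y * z * f .e5
      | .e1 => -(w ^ 2 * f .e12) - z * w * f .e13 - y * f .e14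
      | .e2 => x ^ 2 * f .e12 - z * f .e23 - x * y * f .e24
      | .e3 => x ^ 2 * f .e13 + w * f .e23 - y * f .e35
      | .e4 => x * f .e14 + w ^ 2 * f .e24 - z * f .e45
      | .e5 => w * f .e35 + x * f .e45
      | .e12 => z * f .e123 + y * f .e124
      | .e13 => -(w * f .e123) + y * f .e1345
      | .e14 => -(w ^ 2 * f .e124) - z * w * f .e1345
      | .e23 => x ^ 2 * f .e123 + x * y * f .e2345
      | .e24 => x * f .e124 - z * f .e2345
      | .e35 => x ^ 2 * f .e1345 + x * w * f .e2345
      | .e45 => -(x * w * f .e1345) - w ^ 2 * f .e2345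
      | .e123 => -(y * f .e12345)
      | .e124 => z * f .e12345
      | .e1345 => -(w * f .e12345)
      | .e2345 => x * f .e12345
      | .e12345 => 0 := by
  rw [d_eq_sum, sum_label]
  cases l <;> simp [dBasis, ε] <;> ring

theorem ε_mem (b : Label) : ε k b ∈ grading k b.deg := by
  intro c hc
  have : c ≠ b := by rintro rfl; exact hc rfl
  simp [ε, this]

theorem isInternal_grading : DirectSum.IsInternal (grading k) := by
  rw [DirectSum.isInternal_submodule_iff_iSupIndep_and_iSup_eq_top]
  constructor
  · intro n
    rw [Submodule.disjoint_def]
    intro f hf hf'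
    -- Vectors whose degree-`n` coordinates vanish: this contains every other component.
    let N : Submodule (Poly k) (F k) :=
      ⨅ b : {b : Label // b.deg = n}, LinearMap.ker (LinearMap.proj b.1)
    have hN : ⨆ j, ⨆ (_ : j ≠ n), grading k j ≤ N := by
      refine iSup₂_le fun j hj g hg => ?_
      simp only [N, Submodule.mem_iInf, LinearMap.mem_ker, LinearMap.proj_apply]
      rintro ⟨b, rfl⟩
      exact hg b hj.symm
    have hfN := hN hf'
    simp only [N, Submodule.mem_iInf, LinearMap.mem_ker, LinearMap.proj_apply] at hfN
    funext b
    by_cases hb : b.deg = n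
    · exact hfN ⟨b, hb⟩
    · exact hf b hb
  · rw [eq_top_iff]
    intro f _
    rw [eq_sum_ε f]
    exact Submodule.sum_mem _ fun b _ =>
      Submodule.smul_mem _ _ (Submodule.mem_iSup_of_mem b.deg (ε_mem b))

theorem d_mem (n : ℕ) (a : F k) (ha : a ∈ grading k (n + 1)) : d k a ∈ grading k n := by
  intro l hl
  have h : ∀ b : Label, ¬ b.deg ≠ l.deg + 1 → a b = 0 := fun b hb => ha b (by omega)
  rw [d_apply]
  cases l <;> simp (decide := true) [h]

theorem d_eq_zero_of_mem_zero (a : F k) (ha : a ∈ grading k 0) : d k a = 0 := by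
  have h : ∀ b : Label, b.deg ≠ 0 → a b = 0 := ha
  funext l
  rw [d_apply]
  cases l <;> simp (decide := true) [h]

theorem d_d (a : F k) : d k (d k a) = 0 := by
  funext l
  rw [d_apply]
  cases l <;> simp [d_apply] <;> ring

theorem mem_smul_top (I : Ideal (Poly k)) (f : F k) (hf : ∀ b, f b ∈ I) :
    f ∈ I • (⊤ : Submodule (Poly k) (F k)) := by
  rw [eq_sum_ε f]
  exact Submodule.sum_mem _ fun b _ => Submodule.smul_mem_smul (hf b) trivial

theorem range_d_le : LinearMap.range (d k) ≤
    Ideal.span (Set.range (X : Fin 4 → Poly k)) • (⊤ : Submodule (Poly k) (F k)) := by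
  rintro _ ⟨f, rfl⟩
  apply mem_smul_top
  have hX : ∀ i, (X i : Poly k) ∈ Ideal.span (Set.range (X : Fin 4 → Poly k)) :=
    fun i => Ideal.subset_span ⟨i, rfl⟩
  generalize Ideal.span (Set.range (X : Fin 4 → Poly k)) = I at *
  intro l
  rw [d_apply]
  cases l <;>
  · simp only [pow_two, mul_assoc]
    repeat' first
      | exact I.mul_mem_right _ (hX _)
      | exact I.zero_mem
      | apply I.add_mem
      | apply I.sub_mem
      | apply I.neg_mem

theorem augmentation_F : ∃ π : grading k 0 →ₗ[Poly k] (Poly k ⧸ ideal k),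
    Function.Surjective π ∧ ∀ a : grading k 0, π a = 0 ↔ ∃ b ∈ grading k 1, d k b = a := by
  refine ⟨(Submodule.mkQ (ideal k)).comp ((LinearMap.proj Label.one).comp (grading k 0).subtype),
    ?_, ?_⟩
  · intro q
    obtain ⟨r, rfl⟩ := Submodule.mkQ_surjective _ q
    refine ⟨⟨r • ε k .one, Submodule.smul_mem _ _ (ε_mem .one)⟩, ?_⟩
    simp [ε]
  · rintro ⟨a, ha⟩
    simp only [LinearMap.comp_apply, Submodule.mkQ_apply, Submodule.Quotient.mk_eq_zero,
      Submodule.subtype_apply, LinearMap.proj_apply]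
    constructor
    · intro h
      simp only [ideal, Ideal.mem_span_insert, Ideal.mem_span_singleton'] at h
      obtain ⟨a1, _, ⟨a2, _, ⟨a3, _, ⟨a4, _, ⟨a5, rfl⟩, rfl⟩, rfl⟩, rfl⟩, h⟩ := h
      refine ⟨fun l => match l with
        | .e1 => a1 | .e2 => a2 | .e3 => a3 | .e4 => a4 | .e5 => a5 | _ => 0, ?_, ?_⟩
      · intro l hl
        cases l <;> simp [Label.deg] at hl ⊢
      · have ha' : ∀ b : Label, b.deg ≠ 0 → a b = 0 := ha
        funext l
        rw [d_apply]
        cases l <;> simp (decide := true) [ha']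
        rw [h]; ring
    · rintro ⟨b, -, rfl⟩
      rw [d_apply]
      have hm : ∀ r ∈ ({X 0 ^ 2, X 3 ^ 2, X 2 * X 3, X 0 * X 1, X 1 * X 2} : Set (Poly k)),
        ∀ c, r * c ∈ ideal k := fun r hr c => Ideal.mul_mem_right _ _ (Ideal.subset_span hr)
      refine add_mem (add_mem (add_mem (add_mem ?_ ?_) ?_) ?_) ?_ <;> apply hm <;> simp

/-! ### Division by variables and exactness. -/

/-- Membership is tested on monomials, and a variable from `s` dividing `X i * m` must already
divide `m`. -/
theorem mem_span_X_of_X_mul_mem {σ R : Type*} [CommSemiring R] {s : Set σ} {i : σ} (hi : i ∉ s)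
    {c : MvPolynomial σ R} (h : X i * c ∈ Ideal.span (X '' s)) : c ∈ Ideal.span (X '' s) := by
  classical
  rw [mem_ideal_span_X_image] at h ⊢
  intro m hm
  obtain ⟨j, hj, hmj⟩ := h (Finsupp.single i 1 + m) (by
    rw [mem_support_iff] at hm ⊢
    rwa [coeff_X_mul])
  refine ⟨j, hj, ?_⟩
  have : i ≠ j := by rintro rfl; exact hi hj
  simpa [this] using hmj

theorem exists_of_X_mul_eq_X_mul {R : Type*} [CommRing R] {σ : Type*} {i j : σ} (hij : i ≠ j)
    {p q : MvPolynomial σ R} (h : X i * p = X j * q) : ∃ c, p = X j * c ∧ q = X i * c := by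
  have hp : p ∈ Ideal.span ((X : σ → MvPolynomial σ R) '' {j}) := by
    apply mem_span_X_of_X_mul_mem (i := i) (by simpa using hij)
    rw [h]
    exact Ideal.mul_mem_right _ _ (Ideal.subset_span ⟨j, rfl, rfl⟩)
  rw [Set.image_singleton, Ideal.mem_span_singleton] at hp
  obtain ⟨c, rfl⟩ := hp
  refine ⟨c, rfl, ?_⟩
  rw [mul_left_comm, X_mul_cancel_left_iff] at h
  exact h.symm

theorem exists_of_X_mul_eq_add {R : Type*} [CommRing R] {σ : Type*} {i j l : σ} (hj : i ≠ j)
    (hl : i ≠ l) {p q r : MvPolynomial σ R} (h : X i * p = X j * q + X l * r) :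
    ∃ c e, p = X j * c + X l * e := by
  have hp : p ∈ Ideal.span ((X : σ → MvPolynomial σ R) '' {j, l}) := by
    apply mem_span_X_of_X_mul_mem (i := i) (by simp [hj, hl])
    rw [h]
    exact add_mem (Ideal.mul_mem_right _ _ (Ideal.subset_span ⟨j, by simp, rfl⟩))
      (Ideal.mul_mem_right _ _ (Ideal.subset_span ⟨l, by simp, rfl⟩))
  rw [Set.image_pair, Ideal.mem_span_pair] at hp
  obtain ⟨c, e, rfl⟩ := hp
  exact ⟨c, e, by ring⟩

theorem exists_of_X_mul_eq_add_add {R : Type*} [CommRing R] {σ : Type*} {i j l m : σ}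
    (hj : i ≠ j) (hl : i ≠ l) (hm : i ≠ m) {p q r s : MvPolynomial σ R}
    (h : X i * p = X j * q + X l * r + X m * s) :
    ∃ c e f, p = X j * c + X l * e + X m * f := by
  have hp : p ∈ Ideal.span ((X : σ → MvPolynomial σ R) '' {j, l, m}) := by
    apply mem_span_X_of_X_mul_mem (i := i) (by simp [hj, hl, hm])
    rw [h]
    exact add_mem (add_mem (Ideal.mul_mem_right _ _ (Ideal.subset_span ⟨j, by simp, rfl⟩))
      (Ideal.mul_mem_right _ _ (Ideal.subset_span ⟨l, by simp, rfl⟩)))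
      (Ideal.mul_mem_right _ _ (Ideal.subset_span ⟨m, by simp, rfl⟩))
  rw [Set.image_insert_eq, Set.image_pair] at hp
  simp only [Ideal.mem_span_insert, Ideal.mem_span_singleton'] at hp
  obtain ⟨c, _, ⟨e, _, ⟨f, rfl⟩, rfl⟩, rfl⟩ := hp
  exact ⟨c, e, f, by ring⟩

theorem exact_one (a : F k) (ha : a ∈ grading k 1) (h : d k a = 0) :
    ∃ b ∈ grading k 2, d k b = a := by
  have h0 := congrFun h .one
  simp only [d_apply, Pi.zero_apply] at h0
  have ha' : ∀ b : Label, b.deg ≠ 1 → a b = 0 := ha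
  -- The `ε₅` coordinate lies in `(w, x)`, so boundaries of `ε₃₅` and `ε₄₅` can remove it.
  obtain ⟨α', β', h5⟩ := exists_of_X_mul_eq_add (i := 1) (j := 3) (l := 0) (by decide) (by decide)
    (p := X 2 * a .e5) (q := -(X 3 * a .e2 + X 2 * a .e3)) (r := -(X 0 * a .e1 + X 1 * a .e4))
    (by linear_combination h0)
  obtain ⟨α, β, h5⟩ := exists_of_X_mul_eq_add (by decide) (by decide) h5
  obtain ⟨c, hc1, hc2⟩ := exists_of_X_mul_eq_X_mul (i := (0 : Fin 4)) (j := 3) (by decide)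
    (p := X 0 * a .e1 + X 1 * a .e4 + X 1 * X 2 * β)
    (q := -(X 3 * a .e2 + X 2 * a .e3 + X 1 * X 2 * α))
    (by linear_combination h0 - X 1 * X 2 * h5)
  -- Now `c` lies in `(x, y) ∩ (z, w) = (xz, xw, yz, yw)`; `c3`, `c4`, `c5`, `c6` are its
  -- coefficients on these generators.
  obtain ⟨c1, c2, rfl⟩ := exists_of_X_mul_eq_add (i := 3) (j := 0) (l := 1) (by decide) (by decide)
    (p := c) (q := a .e1) (r := a .e4 + X 2 * β) (by linear_combination -hc1)
  obtain ⟨g, e, hg⟩ := exists_of_X_mul_eq_add (i := 0) (j := 2) (l := 3) (by decide) (by decide)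
    (p := X 0 * c1 + X 1 * c2) (q := -(a .e3 + X 1 * α)) (r := -a .e2)
    (by linear_combination -hc2)
  obtain ⟨m, c3, c4, rfl⟩ := exists_of_X_mul_eq_add_add (i := 0) (j := 1) (l := 2) (m := 3)
    (by decide) (by decide) (by decide) (p := c1) (q := -c2) (r := g) (s := e)
    (by linear_combination hg)
  obtain ⟨c5, c6, h6⟩ := exists_of_X_mul_eq_add (i := 1) (j := 2) (l := 3) (by decide) (by decide)
    (p := X 0 * m + c2) (q := g - X 0 * c3) (r := e - X 0 * c4) (by linear_combination hg)
  -- What remains splits into a syzygy of `x, y` (a multiple of `d ε₁₄`) and one of `w, z` (a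
  -- multiple of `d ε₂₃`).
  obtain ⟨m', h1, h4⟩ := exists_of_X_mul_eq_X_mul (i := (0 : Fin 4)) (j := 1) (by decide)
    (p := -(a .e1 - X 3 * X 2 * c3 - X 3 ^ 2 * c4))
    (q := a .e4 + X 2 * β - X 3 * X 2 * c5 - X 3 ^ 2 * c6)
    (by linear_combination -hc1 - X 1 * X 3 * h6)
  obtain ⟨n, h2, h3⟩ := exists_of_X_mul_eq_X_mul (i := (3 : Fin 4)) (j := 2) (by decide)
    (p := -(a .e2 + X 0 ^ 2 * c4 + X 0 * X 1 * c6))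
    (q := a .e3 + X 1 * α + X 0 ^ 2 * c3 + X 0 * X 1 * c5)
    (by linear_combination hc2 + X 0 * X 1 * h6)
  refine ⟨fun l => match l with
    | .e12 => -c4 | .e13 => -c3 | .e14 => m' | .e23 => n | .e24 => c6 | .e35 => α + X 0 * c5
    | .e45 => β - X 3 * c5 | _ => 0, ?_, ?_⟩
  · intro l hl
    cases l <;> simp [Label.deg] at hl ⊢
  · funext l
    rw [d_apply]
    cases l <;> simp (decide := true) [ha']
    · linear_combination h1
    · linear_combination h2
    · linear_combination -h3
    · linear_combination -h4
    · linear_combination -h5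

theorem exact_two (a : F k) (ha : a ∈ grading k 2) (h : d k a = 0) :
    ∃ b ∈ grading k 3, d k b = a := by
  have h1 := congrFun h .e1
  have h2 := congrFun h .e2
  have h3 := congrFun h .e3
  have h4 := congrFun h .e4
  have h5 := congrFun h .e5
  simp only [d_apply, Pi.zero_apply] at h1 h2 h3 h4 h5
  have ha' : ∀ b : Label, b.deg ≠ 2 → a b = 0 := ha
  obtain ⟨t, h45, h35⟩ := exists_of_X_mul_eq_X_mul (i := (0 : Fin 4)) (j := 3) (by decide)
    (p := -a .e45) (q := a .e35) (by linear_combination -h5)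
  obtain ⟨u', hu', h23⟩ := exists_of_X_mul_eq_X_mul (i := (0 : Fin 4)) (j := 3) (by decide)
    (p := X 1 * t - X 0 * a .e13) (q := a .e23) (by linear_combination -h3 - X 1 * h35)
  -- A preimage must satisfy `t = x r + w s`, by the `ε₃₅` coordinate; this holds because `y t` lies
  -- in `(x, w)`.
  obtain ⟨r, s, ht⟩ := exists_of_X_mul_eq_add (i := 1) (j := 0) (l := 3) (by decide) (by decide)
    (p := t) (q := a .e13) (r := u') (by linear_combination hu')
  obtain ⟨p, h13, hu⟩ := exists_of_X_mul_eq_X_mul (i := (0 : Fin 4)) (j := 3) (by decide)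
    (p := X 1 * r - a .e13) (q := u' - X 1 * s) (by linear_combination hu' - X 1 * ht)
  obtain ⟨v, hv, h14⟩ := exists_of_X_mul_eq_X_mul (i := (3 : Fin 4)) (j := 0) (by decide)
    (p := -(X 3 * a .e24 + X 2 * t)) (q := a .e14) (by linear_combination -h4 + X 2 * h45)
  obtain ⟨q, h24, hq⟩ := exists_of_X_mul_eq_X_mul (i := (3 : Fin 4)) (j := 0) (by decide)
    (p := a .e24 + X 2 * s) (q := -(v + X 2 * r)) (by linear_combination -hv - X 2 * ht)
  have h12 : a .e12 = X 2 * p + X 1 * q := by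
    have : (X 0 ^ 2 : Poly k) ≠ 0 := pow_ne_zero _ (X_ne_zero _)
    apply mul_left_cancel₀ this
    linear_combination h2 + X 2 * h23 + X 2 * X 0 * hu + X 0 * X 1 * h24
  refine ⟨fun l => match l with
    | .e123 => p | .e124 => q | .e1345 => r | .e2345 => s | _ => 0, ?_, ?_⟩
  · intro l hl
    cases l <;> simp [Label.deg] at hl ⊢
  · funext l
    rw [d_apply]
    cases l <;> simp (decide := true) [ha']
    · linear_combination -h12
    · linear_combination h13
    · linear_combination -h14 + X 3 * hq
    · linear_combination -h23 - X 0 * hu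
    · linear_combination -h24
    · linear_combination -h35 - X 0 * ht
    · linear_combination h45 + X 3 * ht

theorem exact_three (a : F k) (ha : a ∈ grading k 3) (h : d k a = 0) :
    ∃ b ∈ grading k 4, d k b = a := by
  have h13 := congrFun h .e13
  have h12 := congrFun h .e12
  have h23 := congrFun h .e23
  simp only [d_apply, Pi.zero_apply] at h13 h12 h23
  have ha' : ∀ b : Label, b.deg ≠ 3 → a b = 0 := ha
  obtain ⟨t, h1345, h123⟩ := exists_of_X_mul_eq_X_mul (i := (1 : Fin 4)) (j := 3) (by decide)
    (p := -a .e1345) (q := -a .e123) (by linear_combination -h13)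
  have h124 : a .e124 = X 2 * t := by
    apply mul_left_cancel₀ (X_ne_zero (R := k) (1 : Fin 4))
    linear_combination h12 + X 2 * h123
  have h2345 : a .e2345 = X 0 * t := by
    apply mul_left_cancel₀ (mul_ne_zero (X_ne_zero (R := k) (0 : Fin 4)) (X_ne_zero (1 : Fin 4)))
    linear_combination h23 + X 0 ^ 2 * h123
  refine ⟨fun l => match l with | .e12345 => t | _ => 0, ?_, ?_⟩
  · intro l hl
    cases l <;> simp [Label.deg] at hl ⊢
  · funext l
    rw [d_apply]
    cases l <;> simp (decide := true) [ha']
    · linear_combination h123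
    · linear_combination -h124
    · linear_combination h1345
    · linear_combination -h2345

theorem eq_zero_of_d_eq_zero (a : F k) (ha : a ∈ grading k 4) (h : d k a = 0) : a = 0 := by
  have h0 := congrFun h .e2345
  have ha' : ∀ b : Label, b.deg ≠ 4 → a b = 0 := ha
  simp [d_apply] at h0
  funext l
  cases l <;> simp (decide := true) [ha', h0]

theorem exact_F (n : ℕ) (a : F k) (ha : a ∈ grading k (n + 1)) (h : d k a = 0) :
    ∃ b ∈ grading k (n + 2), d k b = a := by
  match n with
  | 0 => exact exact_one a ha h
  | 1 => exact exact_two a ha h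
  | 2 => exact exact_three a ha h
  | 3 => exact ⟨0, zero_mem _, by rw [eq_zero_of_d_eq_zero a ha h, map_zero]⟩
  | n + 4 =>
    have ha0 : a = 0 := by
      funext l
      exact ha l (by cases l <;> simp [Label.deg])
    exact ⟨0, zero_mem _, by rw [ha0, map_zero]⟩

/-! ### Coefficient extraction and multidegrees. -/

/-- The coefficient of `x ^ a * y ^ b * z ^ c * w ^ e`. -/
noncomputable def cf (a b c e : ℕ) : Poly k →ₗ[k] k :=
  lcoeff k (Finsupp.equivFunOnFinite.symm ![a, b, c, e])

theorem cf_X_zero_mul (a b c e : ℕ) (p : Poly k) :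
    cf a b c e (X 0 * p) = if a = 0 then 0 else cf (a - 1) b c e p := by
  simp only [cf, lcoeff_apply, coeff_X_mul']
  have : (Finsupp.equivFunOnFinite.symm ![a, b, c, e] - Finsupp.single 0 1 : Fin 4 →₀ ℕ) =
      Finsupp.equivFunOnFinite.symm ![a - 1, b, c, e] := by
    ext i; fin_cases i <;> simp
  simp [this]

theorem cf_X_one_mul (a b c e : ℕ) (p : Poly k) :
    cf a b c e (X 1 * p) = if b = 0 then 0 else cf a (b - 1) c e p := by
  simp only [cf, lcoeff_apply, coeff_X_mul']
  have : (Finsupp.equivFunOnFinite.symm ![a, b, c, e] - Finsupp.single 1 1 : Fin 4 →₀ ℕ) =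
      Finsupp.equivFunOnFinite.symm ![a, b - 1, c, e] := by
    ext i; fin_cases i <;> simp
  simp [this]

theorem cf_X_two_mul (a b c e : ℕ) (p : Poly k) :
    cf a b c e (X 2 * p) = if c = 0 then 0 else cf a b (c - 1) e p := by
  simp only [cf, lcoeff_apply, coeff_X_mul']
  have : (Finsupp.equivFunOnFinite.symm ![a, b, c, e] - Finsupp.single 2 1 : Fin 4 →₀ ℕ) =
      Finsupp.equivFunOnFinite.symm ![a, b, c - 1, e] := by
    ext i; fin_cases i <;> simp
  simp [this]

theorem cf_X_three_mul (a b c e : ℕ) (p : Poly k) :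
    cf a b c e (X 3 * p) = if e = 0 then 0 else cf a b c (e - 1) p := by
  simp only [cf, lcoeff_apply, coeff_X_mul']
  have : (Finsupp.equivFunOnFinite.symm ![a, b, c, e] - Finsupp.single 3 1 : Fin 4 →₀ ℕ) =
      Finsupp.equivFunOnFinite.symm ![a, b, c, e - 1] := by
    ext i; fin_cases i <;> simp
  simp [this]

theorem cf_one (a b c e : ℕ) :
    cf a b c e (1 : Poly k) = if a = 0 ∧ b = 0 ∧ c = 0 ∧ e = 0 then 1 else 0 := by
  simp only [cf, lcoeff_apply, coeff_one]
  congr 1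
  simp [Finsupp.ext_iff, Fin.forall_fin_succ, eq_comm]

theorem cf_x_mul (p q : Poly k) :
    cf 1 0 0 0 (p * q) = cf 1 0 0 0 p * cf 0 0 0 0 q + cf 0 0 0 0 p * cf 1 0 0 0 q := by
  have h0 : (Finsupp.equivFunOnFinite.symm ![0, 0, 0, 0] : Fin 4 →₀ ℕ) = 0 := by
    ext i; fin_cases i <;> simp
  have h1 : (Finsupp.equivFunOnFinite.symm ![1, 0, 0, 0] : Fin 4 →₀ ℕ) = Finsupp.single 0 1 := by
    ext i; fin_cases i <;> simp
  simp only [cf, h0, h1, lcoeff_apply, coeff_mul, Finsupp.antidiagonal_single]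
  simp [Finset.Nat.antidiagonal_succ, add_comm]

/-- The multidegree of a basis element, the exponent of the least common multiple of the
corresponding monomials. -/
noncomputable def multideg (l : Label) : Fin 4 →₀ ℕ :=
  Finsupp.equivFunOnFinite.symm <| match l with
    | .one => ![0, 0, 0, 0]
    | .e1 => ![2, 0, 0, 0]
    | .e2 => ![0, 0, 0, 2]
    | .e3 => ![0, 0, 1, 1]
    | .e4 => ![1, 1, 0, 0]
    | .e5 => ![0, 1, 1, 0]
    | .e12 => ![2, 0, 0, 2]
    | .e13 => ![2, 0, 1, 1]
    | .e14 => ![2, 1, 0, 0]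
    | .e23 => ![0, 0, 1, 2]
    | .e24 => ![1, 1, 0, 2]
    | .e35 => ![0, 1, 1, 1]
    | .e45 => ![1, 1, 1, 0]
    | .e123 => ![2, 0, 1, 2]
    | .e124 => ![2, 1, 0, 2]
    | .e1345 => ![2, 1, 1, 1]
    | .e2345 => ![1, 1, 1, 2]
    | .e12345 => ![2, 1, 1, 2]

theorem cf_eq_coeff (s : Fin 4 →₀ ℕ) (p : Poly k) :
    coeff s p = cf (s 0) (s 1) (s 2) (s 3) p := by
  have : s = Finsupp.equivFunOnFinite.symm ![s 0, s 1, s 2, s 3] := by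
    ext i; fin_cases i <;> simp
  conv_lhs => rw [this]
  rfl

theorem cf_X_zero (a b c e : ℕ) :
    cf a b c e (X 0 : Poly k) = if a = 1 ∧ b = 0 ∧ c = 0 ∧ e = 0 then 1 else 0 := by
  rw [← mul_one (X 0), cf_X_zero_mul, cf_one]
  split_ifs <;> first | rfl | omega

theorem cf_X_one (a b c e : ℕ) :
    cf a b c e (X 1 : Poly k) = if a = 0 ∧ b = 1 ∧ c = 0 ∧ e = 0 then 1 else 0 := by
  rw [← mul_one (X 1), cf_X_one_mul, cf_one]
  split_ifs <;> first | rfl | omega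

theorem cf_X_two (a b c e : ℕ) :
    cf a b c e (X 2 : Poly k) = if a = 0 ∧ b = 0 ∧ c = 1 ∧ e = 0 then 1 else 0 := by
  rw [← mul_one (X 2), cf_X_two_mul, cf_one]
  split_ifs <;> first | rfl | omega

theorem cf_X_three (a b c e : ℕ) :
    cf a b c e (X 3 : Poly k) = if a = 0 ∧ b = 0 ∧ c = 0 ∧ e = 1 then 1 else 0 := by
  rw [← mul_one (X 3), cf_X_three_mul, cf_one]
  split_ifs <;> first | rfl | omega

theorem add_multideg_eq (i j : Label) (s : Fin 4 →₀ ℕ) (hs : s ∈ (dBasis k i j).support) :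
    s + multideg j = multideg i := by
  rw [mem_support_iff, cf_eq_coeff, dBasis] at hs
  cases i <;> cases j <;> simp [ε, pow_two] at hs <;>
  · simp only [cf_X_zero_mul, cf_X_one_mul, cf_X_two_mul, cf_X_three_mul, cf_X_zero, cf_X_one,
      cf_X_two, cf_X_three, ite_eq_left_iff, Classical.not_imp, ite_eq_right_iff] at hs
    ext l
    fin_cases l <;> simp [multideg] <;> omega

theorem isMinimalFreeResolution_F :
    IsMinimalFreeResolution (ideal k) (grading k) (d k) where
  isInternal := isInternal_grading
  map_succ := d_mem
  map_zero := d_eq_zero_of_mem_zero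
  d_comp_d := d_d
  homogeneous_basis := by
    refine ⟨Label, inferInstance, Pi.basisFun (Poly k) Label, Label.deg, multideg, fun i => ?_,
      fun i j s hs => ?_⟩
    · rw [Pi.basisFun_apply]
      exact ε_mem i
    · rw [Pi.basisFun_apply, Pi.basisFun_repr, ← ε, d_ε] at hs
      exact add_multideg_eq i j s hs
  exact := exact_F
  augmentation := augmentation_F
  minimal := range_d_le

/-! ### Coefficients forced by the Leibniz rule, and the associator. -/

variable {μ : F k →ₗ[Poly k] F k →ₗ[Poly k] F k}

theorem ε_apply (b c : Label) : ε k b c = if c = b then 1 else 0 :=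
  Pi.single_apply b 1 c

theorem mul_apply_left (f g : F k) (l : Label) : μ f g l = ∑ b, f b * μ (ε k b) g l := by
  conv_lhs => rw [eq_sum_ε f]
  simp

theorem mul_apply_right (f g : F k) (l : Label) : μ f g l = ∑ b, g b * μ f (ε k b) l := by
  conv_lhs => rw [eq_sum_ε g]
  simp

theorem leibniz_ε (hμ : IsMultiplication (grading k) (d k) μ) (a b : Label) :
    d k (μ (ε k a) (ε k b)) =
      μ (dBasis k a) (ε k b) + (-1 : Poly k) ^ a.deg • μ (ε k a) (dBasis k b) := by
  rw [hμ.leibniz a.deg _ (ε_mem a), d_ε, d_ε]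

theorem mul_ε_one (hμ : IsMultiplication (grading k) (d k) μ)
    (hone : ∀ a, μ (ε k .one) a = a) (b : Label) : μ (ε k b) (ε k .one) = ε k b := by
  have := hμ.graded_comm b.deg 0 _ (ε_mem b) _ (ε_mem .one)
  simpa [hone] using this

theorem cf_e4_mul_e2 (hμ : IsMultiplication (grading k) (d k) μ)
    (hone : ∀ a, μ (ε k .one) a = a) : cf 0 0 0 0 (μ (ε k .e4) (ε k .e2) .e24) = -1 := by
  have h := congrFun (leibniz_ε hμ .e4 .e2) .e4
  rw [d_apply] at h
  have h' := congrArg (cf 0 0 0 2) h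
  simpa [dBasis, hone, mul_ε_one hμ hone, Label.deg, ε_apply, pow_two, mul_assoc, cf_X_zero_mul,
    cf_X_two_mul, cf_X_three_mul, cf_one, cf_X_three] using h'

theorem cf_e45_mul_e2 (hμ : IsMultiplication (grading k) (d k) μ)
    (hone : ∀ a, μ (ε k .one) a = a) : cf 0 0 0 0 (μ (ε k .e45) (ε k .e2) .e2345) = -1 := by
  have h := congrFun (leibniz_ε hμ .e45 .e2) .e24
  rw [d_apply] at h
  have h' := congrArg (cf 0 0 1 0) h
  simpa [dBasis, mul_ε_one hμ hone, Label.deg, ε_apply, cf_X_zero_mul,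
    cf_X_two_mul, cf_e4_mul_e2 hμ hone, neg_eq_iff_eq_neg] using h'

/-- Needed because the `x`-coefficient of the `ε₂₄` coordinate of `ε₁ε₅` is not determined: `d ε₁₂₄`
can change it. -/
theorem cf_e24_mul_e2 (hμ : IsMultiplication (grading k) (d k) μ)
    (hone : ∀ a, μ (ε k .one) a = a) : cf 0 0 0 0 (μ (ε k .e24) (ε k .e2) .e2345) = 0 := by
  have h := congrFun (leibniz_ε hμ .e24 .e2) .e24
  rw [d_apply] at h
  have h' := congrArg (cf 0 0 1 0) h
  simpa [dBasis, mul_ε_one hμ hone, Label.deg, ε_apply, pow_two, mul_assoc, cf_X_zero_mul,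
    cf_X_two_mul, cf_X_three_mul, cf_X_three] using h'

theorem cf_e1_mul_e24 (hμ : IsMultiplication (grading k) (d k) μ)
    (hone : ∀ a, μ (ε k .one) a = a) : cf 0 0 0 0 (μ (ε k .e1) (ε k .e24) .e2345) = 0 := by
  have h := congrFun (leibniz_ε hμ .e1 .e24) .e24
  rw [d_apply] at h
  have h' := congrArg (cf 0 0 1 0) h
  simpa [dBasis, hone, Label.deg, ε_apply, pow_two, mul_assoc, cf_X_zero_mul,
    cf_X_two_mul, cf_X_three_mul, cf_X_zero] using h'

theorem cf_e1_mul_e5_mul_e2 (hμ : IsMultiplication (grading k) (d k) μ)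
    (hone : ∀ a, μ (ε k .one) a = a) :
    cf 1 0 0 0 (μ (μ (ε k .e1) (ε k .e5)) (ε k .e2) .e2345) = -1 := by
  have hdeg : ∀ b : Label, b.deg ≠ 2 → μ (ε k .e1) (ε k .e5) b = 0 :=
    hμ.mul_mem 1 1 _ (ε_mem .e1) _ (ε_mem .e5)
  have h := leibniz_ε hμ .e1 .e5
  generalize μ (ε k .e1) (ε k .e5) = f at h hdeg
  have hd (l : Label) (a b c e : ℕ) := congrArg (cf a b c e) (congrFun h l)
  simp only [d_apply, dBasis, Label.deg, map_smul, hone, mul_ε_one hμ hone, LinearMap.smul_apply,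
    Pi.add_apply, Pi.smul_apply, ε_apply, smul_eq_mul, pow_two, pow_one, mul_assoc] at hd
  have e5 := hd .e5
  have e3 := hd .e3
  have e2 := hd .e2
  have e1 := hd .e1
  simp [cf_X_zero_mul, cf_X_one_mul, cf_X_two_mul, cf_X_three_mul, cf_X_zero, cf_X_two] at e5 e3 e2 e1
  rw [mul_apply_left, sum_label]
  simp (decide := true) only [hdeg, map_add, cf_x_mul, zero_mul, zero_add, add_zero]
  -- These fix every needed coefficient of `f` except that of `x` at `ε₂₄`, which `cf_e24_mul_e2`
  -- kills. The only nonzero one is that of `x` at `ε₄₅`, equal to `1` by comparing `x²` in the `ε₅`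
  -- coordinate.
  have h1 := e5 0 0 0 1
  have h2 := e5 1 0 0 0
  have h3 := e5 2 0 0 0
  have h4 := e3 1 1 0 0
  have h5 := e3 2 0 0 0
  have h6 := e3 3 0 0 0
  have h7 := e3 0 0 0 1
  have h8 := e3 1 0 0 1
  have h9 := e2 2 0 0 0
  have h10 := e2 3 0 0 0
  have h11 := e2 1 1 0 0
  have h12 := e1 0 1 0 0
  have h13 := e1 1 1 0 0
  norm_num at h1 h2 h3 h4 h5 h6 h7 h8 h9 h10 h11 h12 h13
  simp [h1, h2, h3, h4, h5, h6, h7, h8, h9, h10, h11, h12, h13, cf_e45_mul_e2 hμ hone,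
    cf_e24_mul_e2 hμ hone]

theorem cf_e1_mul_mul_e5_e2 (hμ : IsMultiplication (grading k) (d k) μ)
    (hone : ∀ a, μ (ε k .one) a = a) :
    cf 1 0 0 0 (μ (ε k .e1) (μ (ε k .e5) (ε k .e2)) .e2345) = 0 := by
  have hdeg : ∀ b : Label, b.deg ≠ 2 → μ (ε k .e5) (ε k .e2) b = 0 :=
    hμ.mul_mem 1 1 _ (ε_mem .e5) _ (ε_mem .e2)
  have h := leibniz_ε hμ .e5 .e2
  generalize μ (ε k .e5) (ε k .e2) = f at h hdeg
  have hd (l : Label) (a b c e : ℕ) := congrArg (cf a b c e) (congrFun h l)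
  simp only [d_apply, dBasis, Label.deg, map_smul, hone, mul_ε_one hμ hone, LinearMap.smul_apply,
    Pi.add_apply, Pi.smul_apply, ε_apply, smul_eq_mul, pow_two, pow_one, mul_assoc] at hd
  have e5 := hd .e5
  have e3 := hd .e3
  have e2 := hd .e2
  have e1 := hd .e1
  simp [cf_X_zero_mul, cf_X_one_mul, cf_X_two_mul, cf_X_three_mul, cf_X_three, cf_X_two] at e5 e3 e2 e1
  rw [mul_apply_right, sum_label]
  simp (decide := true) only [hdeg, map_add, cf_x_mul, zero_mul, zero_add, add_zero]
  -- The boundary of `f` is now `yz ε₂ - w² ε₅`, with no `x²` at `ε₅`, so the `ε₄₅` contribution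
  -- vanishes too.
  have h1 := e5 0 0 0 1
  have h2 := e5 1 0 0 0
  have h3 := e5 2 0 0 0
  have h4 := e3 1 1 0 0
  have h5 := e3 2 0 0 0
  have h6 := e3 3 0 0 0
  have h7 := e3 0 0 0 1
  have h8 := e3 1 0 0 1
  have h9 := e2 2 0 0 0
  have h10 := e2 3 0 0 0
  have h11 := e2 1 1 0 0
  have h12 := e1 0 1 0 0
  have h13 := e1 1 1 0 0
  norm_num at h1 h2 h3 h4 h5 h6 h7 h8 h9 h10 h11 h12 h13
  simp [h1, h2, h3, h4, h5, h6, h7, h8, h9, h10, h11, h12, h13, cf_e1_mul_e24 hμ hone]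

/-- The terms coming from `d ε₁` and `d ε₂` are scalar multiples of two-fold products and cancel
between the two bracketings; only `d ε₄₅` survives. -/
theorem d_associator (hμ : IsMultiplication (grading k) (d k) μ)
    (hone : ∀ a, μ (ε k .one) a = a) :
    d k (associatorOf μ (ε k .e1) (ε k .e45) (ε k .e2)) =
      -((X 0 : Poly k) • associatorOf μ (ε k .e1) (ε k .e5) (ε k .e2)) +
        (X 2 : Poly k) • associatorOf μ (ε k .e1) (ε k .e4) (ε k .e2) := by
  have hmem := hμ.mul_mem 1 2 _ (ε_mem .e1) _ (ε_mem .e45)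
  have hcomm := hμ.graded_comm 3 0 _ hmem _ (ε_mem .one)
  simp only [associatorOf]
  rw [map_sub]
  rw [hμ.leibniz 3 _ hmem, leibniz_ε hμ, hμ.leibniz 1 _ (ε_mem .e1), leibniz_ε hμ]
  simp [dBasis, hone, mul_ε_one hμ hone, Label.deg, hcomm]
  module

theorem associator_ne_zero_of_one (hμ : IsMultiplication (grading k) (d k) μ)
    (hone : ∀ a, μ (ε k .one) a = a) :
    associatorOf μ (ε k .e1) (ε k .e45) (ε k .e2) ≠ 0 := by
  intro h0
  have h := d_associator hμ hone
  rw [h0, map_zero] at h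
  have h' := congrArg (cf 2 0 0 0) (congrFun h .e2345)
  simp [associatorOf, cf_X_zero_mul, cf_X_two_mul, cf_e1_mul_e5_mul_e2 hμ hone,
    cf_e1_mul_mul_e5_e2 hμ hone] at h'

/-- Up to a scalar, the basis element of degree zero is the unit of any multiplication. -/
theorem exists_smul_one_mul (hμ : IsMultiplication (grading k) (d k) μ) :
    ∃ r : Poly k, ∀ a, r • μ (ε k .one) a = a := by
  obtain ⟨e, he⟩ := hμ.unital
  refine ⟨e .one, fun a => ?_⟩
  have hε (b : Label) : e .one • μ (ε k .one) (ε k b) = ε k b := by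
    funext l
    by_cases hl : l.deg = b.deg
    · have h := congrFun (he (ε k b)).1 l
      -- For degree reasons only the degree-zero part of the unit `e` contributes in the degree of
      -- `b`.
      rw [mul_apply_left, Finset.sum_eq_single Label.one] at h
      · exact h
      · intro c _ hc
        have hc0 : c.deg ≠ 0 := by cases c <;> simp [Label.deg] at hc ⊢
        rw [hμ.mul_mem c.deg b.deg _ (ε_mem c) _ (ε_mem b) l (by omega), mul_zero]
      · simp
    · have h := hμ.mul_mem 0 b.deg _ (ε_mem .one) _ (ε_mem b) l (by omega)
      rw [Pi.smul_apply, h, smul_zero, ε_mem b l hl]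
  conv_lhs => rw [eq_sum_ε a]
  conv_rhs => rw [eq_sum_ε a]
  simp only [map_sum, map_smul, Finset.smul_sum]
  exact Finset.sum_congr rfl fun b _ => by rw [smul_comm, hε]

theorem isMultiplication_smul (hμ : IsMultiplication (grading k) (d k) μ) {r : Poly k}
    (hr : ∀ a, r • μ (ε k .one) a = a) : IsMultiplication (grading k) (d k) (r • μ) where
  mul_mem i j a ha b hb := Submodule.smul_mem _ r (hμ.mul_mem i j a ha b hb)
  leibniz i a ha b := by
    simp only [LinearMap.smul_apply, map_smul, hμ.leibniz i a ha b, smul_add]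
    rw [smul_comm]
  unital := by
    refine ⟨ε k .one, fun a => ⟨hr a, ?_⟩⟩
    conv_lhs => rw [eq_sum_ε a]
    conv_rhs => rw [eq_sum_ε a]
    simp only [map_sum, map_smul, LinearMap.sum_apply, LinearMap.smul_apply]
    refine Finset.sum_congr rfl fun b _ => ?_
    have h := hμ.graded_comm b.deg 0 _ (ε_mem b) _ (ε_mem .one)
    rw [mul_zero, pow_zero, one_smul] at h
    rw [h, hr]
  graded_comm i j a ha b hb := by
    simp only [LinearMap.smul_apply]
    rw [hμ.graded_comm i j a ha b hb, smul_comm]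
  sq_zero i hi a ha := by simp [hμ.sq_zero i hi a ha]

theorem associator_ne_zero (hμ : IsMultiplication (grading k) (d k) μ) :
    associatorOf μ (ε k .e1) (ε k .e45) (ε k .e2) ≠ 0 := by
  obtain ⟨r, hr⟩ := exists_smul_one_mul hμ
  have h := associator_ne_zero_of_one (isMultiplication_smul hμ hr) hr
  contrapose! h
  -- The associator is quadratic in the product.
  have : associatorOf (r • μ) (ε k .e1) (ε k .e45) (ε k .e2) =
      (r * r) • associatorOf μ (ε k .e1) (ε k .e45) (ε k .e2) := by
    simp [associatorOf, smul_sub, mul_smul]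
  rw [this, h, smul_zero]

end Avramov

theorem mainTheorem2 (k : Type*) [Field k] :
    IsMinimalFreeResolution (Avramov.ideal k) (Avramov.grading k) (Avramov.d k) ∧
    ∀ μ : Avramov.F k →ₗ[Avramov.Poly k] Avramov.F k →ₗ[Avramov.Poly k] Avramov.F k,
      IsMultiplication (Avramov.grading k) (Avramov.d k) μ →
        associatorOf μ (Avramov.ε k .e1) (Avramov.ε k .e45) (Avramov.ε k .e2) ≠ 0 :=
  ⟨Avramov.isMinimalFreeResolution_F, fun _ hμ => Avramov.associator_ne_zero hμ⟩
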